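/- Conventions. All processes are indexed by $\mathbb R^d$. A process $X$ is max-stable if for all $t_1,\dots,t_m\in\mathbb R^d$ and $n\ge 1$ the componentwise maximum of $n$ independent copies of $Y=(X_{t_1},\dots,X_{t_m})$ has the law of $a_nY+b_n$ (componentwise) for suitable $a_n\in(0,\infty)^m$, $b_n\in\mathbb R^m$; it has standard Fréchet margins if $\mathbb P(X_t\le x)=e^{-1/x}$ for all $t$ and $x>0$. The tail correlation function (TCF) of such a process is $\chi(t)=\lim_{\tau\to\infty}\mathbb P(X_t\ge\tau\mid X_o\ge\tau)$, $t\in\mathbb R^d$, where $o$ is the origin. * $T^d$ is the set of TCFs of stationary max-stable processes on $\mathbb R^d$ with standard Fréchet margins. * $T^d_{\mathrm{M3r}}$ is the set of TCFs of M3r processes on $\mathbb R^d$, that is, of processes $X$ whose finite-dimensional distributions are given by $$-\log\mathbb P(X_{t_k}\le x_k,\ k=1,\dots,m)=\mathbb E_f\int_{\mathbb R^d}\max_{1\le k\le m}\frac{f(t_k-z)}{x_k}\,dz\qquad(x_k>0),$$ for a measurable random function $f:\mathbb R^d\to[0,\infty]$ with $\mathbb E_f\int_{\mathbb R^d} f(t)\,dt=1$,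 each realization of which is radially symmetric around $o$ and non-increasing in the radius. * $T^d_r$ is the set of continuous functions $\varphi$ on $[0,\infty)$ that are convex, vanish at infinity, and for which $t\mapsto\varphi(\lVert t\rVert)$ belongs to $T^d$. A function $\varphi$ on $[0,\infty)$ is said to belong to $T^k$ or $T^k_{\mathrm{M3r}}$ if $t\mapsto\varphi(\lVert t\rVert)$, $t\in\mathbb R^k$, does. Proposition 4.8. For $d\ge1$ let $$\varphi_d(\lVert t\rVert)=\int_{S^{d-1}}\bigl(1-|\langle a,t\rangle|\bigr)_+\,\sigma(da),\qquad t\in\mathbb R^d,$$ where $\sigma$ is the uniform distribution on the unit sphere $S^{d-1}\subset\mathbb R^d$; this is the image of the tent function $(1-|s|)_+$, $s\in\mathbb R$, under the turning bands operator $\mathrm{TB}^d_1$. The right-hand side depends on $\lVert t\rVert$ only, so that $\varphi_d$ is a well-defined function on $[0,\infty)$, and: (a) For $d\ge1$ we have $\varphi_d\in T^d_r$; moreover $\varphi_d\in T^d\cap T^1_{\mathrm{M3r}}$. (b) For $d\ge1$ and $k\ge3$ we have $\varphi_d\notin T^k_{\mathrm{M3r}}$. (c) For $d=1$ and for $d\ge6$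 we have $\varphi_d\notin T^2_{\mathrm{M3r}}$. -/

import Mathlib

open MeasureTheory ProbabilityTheory Set Filter Topology
open scoped ENNReal

/-- The Euclidean space `ℝ^d`. -/
abbrev Euc (d : ℕ) : Type := EuclideanSpace ℝ (Fin d)

section Processes

variable {d : ℕ} {Ω : Type} [MeasurableSpace Ω]

/-- The law of the random vector `(X_{t_1}, …, X_{t_m})`. -/
noncomputable def fddLaw (P : Measure Ω) (X : Euc d → Ω → ℝ) {m : ℕ} (t : Fin m → Euc d) :
    Measure (Fin m → ℝ) :=
  P.map (fun ω k => X (t k) ω)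

/-- Strict stationarity: the finite-dimensional laws are invariant under translations. -/
def IsStationaryProcess (P : Measure Ω) (X : Euc d → Ω → ℝ) : Prop :=
  ∀ (m : ℕ) (t : Fin m → Euc d) (h : Euc d), fddLaw P X (fun k => t k + h) = fddLaw P X t

/-- Max-stability: for all `t_1, …, t_m` and `n ≥ 1`, the componentwise maximum of `n` independent
copies of `Y = (X_{t_1}, …, X_{t_m})` has the law of `a Y + b` (componentwise operations) for
suitable vectors `a > 0` and `b`, which may depend on `n`. -/
def IsMaxStableProcess (P : Measure Ω) (X : Euc d → Ω → ℝ) : Prop :=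
  ∀ (m : ℕ) (t : Fin m → Euc d) (n : ℕ), 1 ≤ n →
    ∃ a b : Fin m → ℝ, (∀ k, 0 < a k) ∧
      (Measure.pi (fun _ : Fin n => fddLaw P X t)).map (fun y k => ⨆ i, y i k) =
        (fddLaw P X t).map (fun y k => a k * y k + b k)

/-- Standard Fréchet margins: `ℙ(X_t ≤ x) = exp (-1/x)` for `x > 0`. -/
def HasStdFrechetMargins (P : Measure Ω) (X : Euc d → Ω → ℝ) : Prop :=
  ∀ (t : Euc d) (x : ℝ), 0 < x → P {ω | X t ω ≤ x} = ENNReal.ofReal (Real.exp (-1 / x))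

/-- `χ` is the tail correlation function of the process `X`:
`χ(t) = lim_{τ ↑ ∞} ℙ(X_t ≥ τ ∣ X_o ≥ τ)` for every `t`. The upper endpoint of the margins is `∞`
here, since only processes with standard Fréchet margins are considered. -/
def HasTCF (P : Measure Ω) (X : Euc d → Ω → ℝ) (χ : Euc d → ℝ) : Prop :=
  ∀ t : Euc d,
    Tendsto (fun τ : ℝ => (P[|{ω | τ ≤ X 0 ω}]).real {ω | τ ≤ X t ω}) atTop (𝓝 (χ t))

/-- The process `X` has the law of `⋁_n U_n V_t(s_n)`, where `(U_n, s_n)` is a Poisson point process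
on `(0,∞) × S` with intensity `u⁻² du × ν(ds)`. The law is prescribed through its
finite-dimensional distributions
`-log ℙ(X_{t_k} ≤ x_k, k = 1, …, m) = ∫_S max_k V_{t_k}(s) / x_k ν(ds)`, `x_k > 0`
(the right-hand side is finite since `∫_S V_t dν = 1` for all `t`). -/
structure HasSpectralRepresentation {S : Type} [MeasurableSpace S] (P : Measure Ω)
    (X : Euc d → Ω → ℝ) (ν : Measure S) (V : Euc d → S → ℝ≥0∞) : Prop where
  measurable_spectral : ∀ t, Measurable (V t)
  lintegral_spectral : ∀ t, ∫⁻ s, V t s ∂ν = 1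
  fdd : ∀ (m : ℕ) (t : Fin m → Euc d) (x : Fin m → ℝ), (∀ k, 0 < x k) →
    P {ω | ∀ k, X (t k) ω ≤ x k} =
      ENNReal.ofReal (Real.exp (-(∫⁻ s, ⨆ k, V (t k) s / ENNReal.ofReal (x k) ∂ν).toReal))

/-- `f` is a random shape function on `ℝ^d` (defined on the probability space `(F, Q)`, with values
in `[0,∞]`) of total mean mass one, each realization of which is radially symmetric and
non-increasing in the radius. (The field `radial_antitone` expresses both properties: applied in
both directions to points of equal norm, it gives radial symmetry.) -/
structure IsRadialShape {F : Type} [MeasurableSpace F] (Q : Measure F) (f : F → Euc d → ℝ≥0∞) :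
    Prop where
  isProbabilityMeasure : IsProbabilityMeasure Q
  measurable : Measurable (Function.uncurry f)
  lintegral_eq_one : ∫⁻ ω, ∫⁻ t, f ω t ∂volume ∂Q = 1
  radial_antitone : ∀ ω s t, ‖s‖ ≤ ‖t‖ → f ω t ≤ f ω s

/-- `X` is a mixed moving maxima process with radial non-increasing random shapes (M3r process):
its spectral functions are `V_t(z, f) = f (t - z)` on `ℝ^d × F` with the product of Lebesgue measure
and the law of the random shape `f`. -/
def IsM3rProcess (P : Measure Ω) (X : Euc d → Ω → ℝ) : Prop :=
  ∃ (F : Type) (_ : MeasurableSpace F) (Q : Measure F) (f : F → Euc d → ℝ≥0∞),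
    IsRadialShape Q f ∧
      HasSpectralRepresentation P X ((volume : Measure (Euc d)).prod Q)
        (fun t s => f s.2 (t - s.1))

end Processes

/-- The set of all tail correlation functions on `ℝ^d`, i.e. of the TCFs of stationary max-stable
processes on `ℝ^d` with standard Fréchet margins. -/
def tcfSet (d : ℕ) : Set (Euc d → ℝ) :=
  {χ | ∃ (Ω : Type) (_ : MeasurableSpace Ω) (P : Measure Ω) (X : Euc d → Ω → ℝ),
    IsProbabilityMeasure P ∧ (∀ t, Measurable (X t)) ∧ IsStationaryProcess P X ∧
      IsMaxStableProcess P X ∧ HasStdFrechetMargins P X ∧ HasTCF P X χ}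

/-- The set of tail correlation functions of M3r processes on `ℝ^d`. -/
def tcfM3r (d : ℕ) : Set (Euc d → ℝ) :=
  {χ | ∃ (Ω : Type) (_ : MeasurableSpace Ω) (P : Measure Ω) (X : Euc d → Ω → ℝ),
    IsProbabilityMeasure P ∧ (∀ t, Measurable (X t)) ∧ IsM3rProcess P X ∧ HasTCF P X χ}

/-- The function on `ℝ^d` that depends on the radius only, with radial profile `φ` on `[0,∞)`
(the values of `φ` on `(-∞,0)` play no role). -/
noncomputable def radialFun (d : ℕ) (φ : ℝ → ℝ) : Euc d → ℝ := fun t => φ ‖t‖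

/-- The (profiles of) continuous radial TCFs on `ℝ^d` that are convex in the radius and vanish at
infinity. -/
def radialConvexTCF (d : ℕ) : Set (ℝ → ℝ) :=
  {φ | radialFun d φ ∈ tcfSet d ∧ ContinuousOn φ (Ici 0) ∧ ConvexOn ℝ (Ici 0) φ ∧
    Tendsto φ atTop (𝓝 0)}

/-- The turning bands operator `TB^d_1`. The Stiefel manifold of orthonormal `1`-frames in `ℝ^d` is
the unit sphere, `Aᵀ t` is the inner product of `a` and `t`, and the uniform distribution is the
normalized surface measure of the sphere (`⨍` is the mean value with respect to a finite measure).
The operator is meant for continuous `f`, for which the integrand is bounded. -/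
noncomputable def turningBandsOne (d : ℕ) (f : ℝ → ℝ) : Euc d → ℝ := fun t =>
  ⨍ a : Metric.sphere (0 : Euc d) 1, f (inner ℝ (a : Euc d) t)
    ∂(volume : Measure (Euc d)).toSphere

/-- The tent function `(1 - |s|)₊` on `ℝ`. -/
noncomputable def tent (s : ℝ) : ℝ := max (1 - |s|) 0

/-- The radial profile `φ_d` of `TB^d_1(tent)`, read off along the first coordinate axis. -/
noncomputable def tentTB (d : ℕ) [NeZero d] : ℝ → ℝ := fun r =>
  turningBandsOne d tent (EuclideanSpace.single (0 : Fin d) r)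

/-! A spectral representation with measure `ν` and functions `V` turns every claim about tail
correlation into one about integrals: the TCF is `t ↦ ∫ min (V 0) (V t) dν`
(`HasSpectralRepresentation.hasTCF`). A process with given `V` exists as a supremum over a Poisson
process (`exists_hasSpectralRepresentation`).

Part (a) then needs two choices of `V`. Since the tent at `s` is the overlap of two unit intervals
with centres `s` apart, indicators of randomly oriented bands of width one realize `φ_d` in `ℝ^d`.
On the line, centred intervals of length `1 / |a 0|` and height `|a 0|`, with `a` uniform on the
sphere, give an M3r process with the same profile.

Parts (b) and (c) share one obstruction, valid in all dimensions `k ≥ 2`. As `|a 0| ≤ 1`, the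
profile is affine on `[0,1]`, so its second difference over `0, 1/2, 1` vanishes. For an M3r process
and `‖u‖ = 1/2`, monotonicity of the shape gives the pointwise bound `min (V 0) (V u) + min (V u) (V
2u) ≤ V u + min (V 0) (V 2u)`; the vanishing second difference makes the integrals equal, hence `V u
≤ max (V 0) (V 2u)` almost everywhere. A direction orthogonal to `u` shows that such a radial shape
is constant off the origin (`radial_const_of_ae_le_max`). Being integrable it is null, against its
mean mass one. -/

/-! ### Poisson construction of processes with a given spectral representation -/

theorem measurableSet_forall_lt_mem {E : Type*} [MeasurableSpace E] {G : Set E}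
    (hG : MeasurableSet G) : MeasurableSet {p : ℕ × (ℕ → E) | ∀ j < p.1, p.2 j ∈ G} := by
  have : {p : ℕ × (ℕ → E) | ∀ j < p.1, p.2 j ∈ G} =
      ⋂ j, ({p | p.1 ≤ j} ∪ {p | p.2 j ∈ G}) := by
    ext p
    simp only [mem_ofPred_eq, mem_iInter, mem_union]
    exact forall_congr' fun j => by rw [← not_lt, imp_iff_not_or]
  rw [this]
  refine MeasurableSet.iInter fun j => MeasurableSet.union ?_ ?_
  · exact measurable_fst (measurableSet_Iic (a := j))
  · exact (measurable_pi_apply j).comp measurable_snd hG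

/-- Conditioning on the number `n` of points gives `Q G ^ n`, and summing against the Poisson
weights yields `exp (-c (1 - Q G))`: the void probability of `Gᶜ` for a Poisson process of intensity
`c • Q`. -/
theorem poissonMeasure_prod_infinitePi_forall_mem {E : Type*} [MeasurableSpace E] (Q : Measure E)
    [IsProbabilityMeasure Q] (c : NNReal) {G : Set E} (hG : MeasurableSet G) :
    ((poissonMeasure c).prod (Measure.infinitePi fun _ : ℕ => Q)) {p | ∀ j < p.1, p.2 j ∈ G} =
      ENNReal.ofReal (Real.exp (-(c * Q Gᶜ).toReal)) := by
  have hmeas := measurableSet_forall_lt_mem hG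
  have hsec (n : ℕ) : (Measure.infinitePi fun _ : ℕ => Q)
      (Prod.mk n ⁻¹' {p : ℕ × (ℕ → E) | ∀ j < p.1, p.2 j ∈ G}) = Q G ^ n := by
    have : (Prod.mk n ⁻¹' {p : ℕ × (ℕ → E) | ∀ j < p.1, p.2 j ∈ G}) =
        ((Finset.range n : Set ℕ)).pi fun _ => G := by
      ext p; simp [Set.mem_pi]
    rw [this, Measure.infinitePi_pi _ (fun _ _ => hG)]
    simp
  rw [Measure.prod_apply hmeas]
  simp_rw [hsec]
  rw [lintegral_countable']
  simp_rw [poissonMeasure_singleton]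
  have hq : Q G = ENNReal.ofReal (Q.real G) := by simp
  have hcompl : (c * Q Gᶜ).toReal = c - c * Q.real G := by
    rw [ENNReal.toReal_mul, ← measureReal_def, probReal_compl_eq_one_sub hG]
    simp; ring
  have hs : HasSum (fun n : ℕ => Q.real G ^ n * (Real.exp (-c) * (c : ℝ) ^ n / (n.factorial : ℝ)))
      (Real.exp (-(c * Q Gᶜ).toReal)) := by
    have := (NormedSpace.expSeries_div_hasSum_exp (c * Q.real G : ℝ)).mul_left (Real.exp (-c))
    rw [← Real.exp_eq_exp_ℝ, ← Real.exp_add] at this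
    convert! this using 1
    · ext n; rw [mul_pow]; ring
    · rw [hcompl]; congr 1; ring
  rw [hq, ← hs.tsum_eq, ENNReal.ofReal_tsum_of_nonneg (fun n => by positivity) hs.summable]
  congr 1
  ext n
  rw [ENNReal.ofReal_mul (by positivity), ENNReal.ofReal_pow (by positivity)]

theorem exists_eq_nnreal_smul_probabilityMeasure {E : Type*} [MeasurableSpace E] [Nonempty E]
    (M : Measure E) [IsFiniteMeasure M] :
    ∃ (c : NNReal) (Q : Measure E), IsProbabilityMeasure Q ∧ M = c • Q := by
  by_cases h : M = 0
  · exact ⟨0, Measure.dirac (Classical.arbitrary E), inferInstance, by simp [h]⟩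
  · have : NeZero M := ⟨h⟩
    refine ⟨(M univ).toNNReal, (M univ)⁻¹ • M, inferInstance, ?_⟩
    ext s _
    simp only [Measure.smul_apply, smul_eq_mul, ENNReal.smul_def]
    rw [ENNReal.coe_toNNReal (measure_ne_top _ _), ← mul_assoc,
      ENNReal.mul_inv_cancel (by simpa using h) (measure_ne_top _ _), one_mul]

theorem infinitePi_forall_mem_of_exp {Y : ℕ → Type*} [∀ i, MeasurableSpace (Y i)]
    (P : ∀ i, Measure (Y i)) [∀ i, IsProbabilityMeasure (P i)] {G : ∀ i, Set (Y i)}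
    (hG : ∀ i, MeasurableSet (G i)) {a : ℕ → ℝ≥0∞}
    (ha : ∑' i, a i ≠ ∞) (h : ∀ i, P i (G i) = ENNReal.ofReal (Real.exp (-(a i).toReal))) :
    Measure.infinitePi P {ω | ∀ i, ω i ∈ G i} =
      ENNReal.ofReal (Real.exp (-(∑' i, a i).toReal)) := by
  have hset : {ω : ∀ i, Y i | ∀ i, ω i ∈ G i} = univ.pi G := by ext; simp [Set.mem_pi]
  rw [hset, Measure.infinitePi_pi_univ _ hG]
  simp_rw [h]
  have hs : HasSum (fun i => -(a i).toReal) (-(∑' i, a i).toReal) :=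
    by
      rw [ENNReal.tsum_toReal_eq (ENNReal.ne_top_of_tsum_ne_top ha)]
      exact (ENNReal.hasSum_toReal ha).neg
  have hp := hs.rexp
  have : HasProd (fun i => ENNReal.ofReal (Real.exp (-(a i).toReal)))
      (ENNReal.ofReal (Real.exp (-(∑' i, a i).toReal))) := by
    unfold HasProd at hp ⊢
    refine (ENNReal.tendsto_ofReal hp).congr fun s => ?_
    exact ENNReal.ofReal_prod_of_nonneg fun i _ => (Real.exp_pos _).le
  exact this.tprod_eq

/-- The measure `M` is a countable sum of finite pieces `c i • Q i`. Each piece carries a Poisson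
number of independent points, independently of the others, and `Z t` is the supremum of `g t` over
all points. `Z ≤ x` says that no point hits the exceedance set, so void probabilities multiply. -/
theorem exists_poisson_sup {E T : Type} [MeasurableSpace E] [Nonempty E] (M : Measure E)
    [SFinite M] {g : T → E → ℝ≥0∞} (hg : ∀ t, Measurable (g t)) :
    ∃ (Ω : Type) (_ : MeasurableSpace Ω) (P : Measure Ω) (Z : T → Ω → ℝ≥0∞),
      IsProbabilityMeasure P ∧ (∀ t, Measurable (Z t)) ∧
      ∀ (m : ℕ) (t : Fin m → T) (x : Fin m → ℝ≥0∞), M {e | ∃ k, x k < g (t k) e} ≠ ∞ →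
        P {ω | ∀ k, Z (t k) ω ≤ x k} =
          ENNReal.ofReal (Real.exp (-(M {e | ∃ k, x k < g (t k) e}).toReal)) := by
  choose c Q hQ hM using fun i => exists_eq_nnreal_smul_probabilityMeasure (sfiniteSeq M i)
  refine ⟨ℕ → ℕ × (ℕ → E), inferInstance,
    Measure.infinitePi fun i => (poissonMeasure (c i)).prod (Measure.infinitePi fun _ : ℕ => Q i),
    fun t ω => ⨆ i, ⨆ j, if j < (ω i).1 then g t ((ω i).2 j) else 0, inferInstance, ?_, ?_⟩
  · intro t
    refine Measurable.iSup fun i => Measurable.iSup fun j => Measurable.ite ?_ ?_ measurable_const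
    · exact (measurable_fst.comp (measurable_pi_apply i)) (measurableSet_Ioi (a := j))
    · exact (hg t).comp ((measurable_pi_apply j).comp (measurable_snd.comp (measurable_pi_apply i)))
  · intro m t x hfin
    have hGm : MeasurableSet {e | ∀ k, g (t k) e ≤ x k} := by
      simp_rw [ofPred_forall]
      exact MeasurableSet.iInter fun k => hg (t k) measurableSet_Iic
    have hc : {e | ∃ k, x k < g (t k) e} = {e | ∀ k, g (t k) e ≤ x k}ᶜ := by ext; simp
    have hsum : M {e | ∃ k, x k < g (t k) e} =
        ∑' i, (c i : ℝ≥0∞) * Q i {e | ∀ k, g (t k) e ≤ x k}ᶜ := by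
      conv_lhs => rw [← sum_sfiniteSeq M, hc, Measure.sum_apply _ hGm.compl]
      congr 1; ext i
      rw [hM i]; rfl
    rw [hsum] at hfin ⊢
    rw [← infinitePi_forall_mem_of_exp _ ?_ hfin
      (fun i => poissonMeasure_prod_infinitePi_forall_mem (Q i) (c i) hGm)]
    · congr 1
      ext ω
      simp only [mem_ofPred_eq, iSup_le_iff]
      constructor
      · intro h i j hj k
        simpa [hj] using h k i j
      · intro h k i j
        split_ifs with hj
        · exact h i j hj k
        · exact zero_le
    · exact fun i => measurableSet_forall_lt_mem hGm

/-- The exceedance condition amounts to `y < v k / x k` for some `k`. The coordinate `y = 1/u`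
replaces the intensity `u⁻² du` by Lebesgue measure. -/
theorem volume_restrict_Ioi_lt_div {m : ℕ} (v : Fin m → ℝ≥0∞) {x : Fin m → ℝ}
    (hx : ∀ k, 0 < x k) :
    (volume.restrict (Ioi (0 : ℝ)))
      {y | ∃ k, ENNReal.ofReal (x k) < v k / ENNReal.ofReal y} =
        ⨆ k, v k / ENNReal.ofReal (x k) := by
  set a := ⨆ k, v k / ENNReal.ofReal (x k) with ha
  have hset : {y | ∃ k, ENNReal.ofReal (x k) < v k / ENNReal.ofReal y} ∩ Ioi (0 : ℝ) =
      {y | 0 < y ∧ ENNReal.ofReal y < a} := by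
    ext y
    simp only [mem_inter_iff, mem_ofPred_eq, mem_Ioi, ha, lt_iSup_iff]
    rw [and_comm]
    refine and_congr_right fun hy => exists_congr fun k => ?_
    rw [ENNReal.lt_div_iff_mul_lt (by simp [hy]) (by simp),
      ENNReal.lt_div_iff_mul_lt (by simp [hx k]) (by simp), mul_comm]
  rw [Measure.restrict_apply' measurableSet_Ioi, hset]
  by_cases hat : a = ∞
  · simp only [hat, ENNReal.ofReal_lt_top, and_true]
    exact Real.volume_Ioi
  · have : {y : ℝ | 0 < y ∧ ENNReal.ofReal y < a} = Ioo 0 a.toReal := by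
      ext y
      simp only [mem_ofPred_eq, mem_Ioo]
      refine and_congr_right fun hy => ?_
      rw [ENNReal.ofReal_lt_iff_lt_toReal hy.le hat]
    rw [this, Real.volume_Ioo, sub_zero, ENNReal.ofReal_toReal hat]

theorem lintegral_iSup_div_ne_top {d : ℕ} {S : Type} [MeasurableSpace S] {ν : Measure S}
    {V : Euc d → S → ℝ≥0∞} (hV : ∀ t, Measurable (V t)) (hV1 : ∀ t, ∫⁻ s, V t s ∂ν = 1)
    {m : ℕ} (t : Fin m → Euc d) {x : Fin m → ℝ} (hx : ∀ k, 0 < x k) :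
    ∫⁻ s, ⨆ k, V (t k) s / ENNReal.ofReal (x k) ∂ν ≠ ∞ := by
  refine ne_top_of_le_ne_top (b := ∑ k, (1 : ℝ≥0∞) / ENNReal.ofReal (x k)) ?_ ?_
  · refine ENNReal.sum_ne_top.2 fun k _ => ENNReal.div_ne_top ENNReal.one_ne_top ?_
    simp [hx k]
  · calc ∫⁻ s, ⨆ k, V (t k) s / ENNReal.ofReal (x k) ∂ν
        ≤ ∫⁻ s, ∑ k, V (t k) s / ENNReal.ofReal (x k) ∂ν :=
          lintegral_mono fun s => iSup_le fun k =>
            Finset.single_le_sum (f := fun k => V (t k) s / ENNReal.ofReal (x k))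
              (fun _ _ => zero_le) (Finset.mem_univ k)
      _ = ∑ k, (1 : ℝ≥0∞) / ENNReal.ofReal (x k) := by
          rw [lintegral_finsetSum _ fun k _ => (hV (t k)).div_const _]
          refine Finset.sum_congr rfl fun k _ => ?_
          simp_rw [div_eq_mul_inv]
          rw [lintegral_mul_const _ (hV (t k)), hV1]

theorem exists_hasSpectralRepresentation {d : ℕ} {S : Type} [MeasurableSpace S] (ν : Measure S)
    [SFinite ν] {V : Euc d → S → ℝ≥0∞} (hV : ∀ t, Measurable (V t))
    (hV1 : ∀ t, ∫⁻ s, V t s ∂ν = 1) :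
    ∃ (Ω : Type) (_ : MeasurableSpace Ω) (P : Measure Ω) (X : Euc d → Ω → ℝ),
      IsProbabilityMeasure P ∧ (∀ t, Measurable (X t)) ∧ HasSpectralRepresentation P X ν V := by
  have hne : Nonempty S := by
    by_contra h
    rw [not_nonempty_iff] at h
    simpa using hV1 0
  let M : Measure (ℝ × S) := (volume.restrict (Ioi (0 : ℝ))).prod ν
  let g : Euc d → ℝ × S → ℝ≥0∞ := fun t e => V t e.2 / ENNReal.ofReal e.1
  have hg : ∀ t, Measurable (g t) := fun t =>
    ((hV t).comp measurable_snd).div (ENNReal.measurable_ofReal.comp measurable_fst)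
  have hM : ∀ (m : ℕ) (t : Fin m → Euc d) (x : Fin m → ℝ), (∀ k, 0 < x k) →
      M {e | ∃ k, ENNReal.ofReal (x k) < g (t k) e} =
        ∫⁻ s, ⨆ k, V (t k) s / ENNReal.ofReal (x k) ∂ν := by
    intro m t x hx
    have hms : MeasurableSet {e | ∃ k, ENNReal.ofReal (x k) < g (t k) e} := by
      simp_rw [ofPred_exists]
      exact MeasurableSet.iUnion fun k => hg (t k) measurableSet_Ioi
    rw [Measure.prod_apply_symm hms]
    exact lintegral_congr fun s => volume_restrict_Ioi_lt_div (fun k => V (t k) s) hx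
  obtain ⟨Ω, mΩ, P, Z, hP, hZ, hfdd⟩ := exists_poisson_sup M hg
  have key : ∀ (m : ℕ) (t : Fin m → Euc d) (x : Fin m → ℝ), (∀ k, 0 < x k) →
      P {ω | ∀ k, Z (t k) ω ≤ ENNReal.ofReal (x k)} =
        ENNReal.ofReal (Real.exp (-(∫⁻ s, ⨆ k, V (t k) s / ENNReal.ofReal (x k) ∂ν).toReal)) := by
    intro m t x hx
    rw [hfdd m t (fun k => ENNReal.ofReal (x k)) , hM m t x hx]
    rw [hM m t x hx]
    exact lintegral_iSup_div_ne_top hV hV1 t hx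
  -- The Poisson supremum may be infinite on a null set only: `Z t ≤ n + 1` has probability `exp (-1
  -- / (n + 1))`, which tends to one.
  have hfin : ∀ t, ∀ᵐ ω ∂P, Z t ω ≠ ∞ := by
    intro t
    have hle : ∀ n : ℕ, ENNReal.ofReal (Real.exp (-1 / (n + 1 : ℝ))) ≤ P {ω | Z t ω ≠ ∞} := by
      intro n
      have h1 := key 1 (fun _ => t) (fun _ => (n + 1 : ℝ)) (fun _ => by positivity)
      have h2 : (∫⁻ s, ⨆ _ : Fin 1, V t s / ENNReal.ofReal (n + 1 : ℝ) ∂ν).toReal =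
          1 / (n + 1 : ℝ) := by
        simp_rw [ciSup_const, div_eq_mul_inv]
        rw [lintegral_mul_const _ (hV t), hV1, one_mul, ENNReal.toReal_inv,
          ENNReal.toReal_ofReal (by positivity), one_mul]
      rw [h2, ← neg_div] at h1
      rw [← h1]
      refine measure_mono fun ω hω => ne_top_of_le_ne_top ENNReal.ofReal_ne_top (hω 0)
    have hlim : Tendsto (fun n : ℕ => ENNReal.ofReal (Real.exp (-1 / (n + 1 : ℝ)))) atTop (𝓝 1) := by
      have : Tendsto (fun n : ℕ => Real.exp (-1 / (n + 1 : ℝ))) atTop (𝓝 (Real.exp 0)) := by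
        refine (Real.continuous_exp.tendsto 0).comp ?_
        have := (tendsto_one_div_add_atTop_nhds_zero_nat (𝕜 := ℝ)).neg
        simpa [neg_div] using this
      simpa using ENNReal.tendsto_ofReal this
    have h1 : P {ω | Z t ω ≠ ∞} = 1 :=
      le_antisymm prob_le_one (le_of_tendsto' hlim hle)
    exact (prob_compl_eq_zero_iff (hZ t (measurableSet_singleton ∞).compl)).2 h1
  refine ⟨Ω, mΩ, P, fun t ω => (Z t ω).toReal, hP, fun t => (hZ t).ennreal_toReal, hV, hV1, ?_⟩
  intro m t x hx
  rw [← key m t x hx]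
  refine measure_congr ?_
  filter_upwards [ae_all_iff.2 fun k => hfin (t k)] with ω hω
  refine propext (forall_congr' fun k => ?_)
  exact (ENNReal.le_ofReal_iff_toReal_le (hω k) (hx k).le).symm

/-! ### Consequences of a spectral representation: stationarity, max-stability, TCF -/

theorem measure_pi_ext_of_Iic {m : ℕ} {μ μ' : Measure (Fin m → ℝ)} [IsProbabilityMeasure μ]
    [IsProbabilityMeasure μ'] (h : ∀ x, μ (Iic x) = μ' (Iic x)) : μ = μ' := by
  have hgen : (MeasurableSpace.pi : MeasurableSpace (Fin m → ℝ)) =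
      MeasurableSpace.generateFrom (range Iic) := by
    have h1 := @generateFrom_pi_eq (Fin m) (fun _ => ℝ) _ (fun _ => range Iic) fun _ =>
      ⟨fun n : ℕ => Iic (n : ℝ), fun n => mem_range_self _, by
        refine eq_univ_of_forall fun y => mem_iUnion.2 (exists_nat_ge y)⟩
    have h2 : (fun _ : Fin m => (inferInstance : MeasurableSpace ℝ)) =
        fun _ => MeasurableSpace.generateFrom (range Iic) := by
      funext
      rw [← borel_eq_generateFrom_Iic, ← (inferInstance : BorelSpace ℝ).measurable_eq]
    have h3 : (univ.pi '' univ.pi fun _ : Fin m => range (Iic : ℝ → Set ℝ)) = range Iic := by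
      ext s
      constructor
      · rintro ⟨f, hf, rfl⟩
        choose x hx using fun i => hf i (mem_univ i)
        refine ⟨x, ?_⟩
        rw [← pi_univ_Iic]
        simp only [hx]
      · rintro ⟨x, rfl⟩
        exact ⟨fun i => Iic (x i), fun i _ => mem_range_self _, pi_univ_Iic x⟩
    rw [h3] at h1
    rw [← h1]
    exact congrArg _ h2
  refine ext_of_generate_finite _ hgen ?_ ?_ (by simp)
  · rintro _ ⟨x, rfl⟩ _ ⟨y, rfl⟩ _
    exact ⟨x ⊓ y, Iic_inter_Iic.symm⟩
  · rintro _ ⟨x, rfl⟩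
    exact h x

section Spectral

variable {d : ℕ} {Ω S : Type} [MeasurableSpace Ω] [MeasurableSpace S] {P : Measure Ω}
  {X : Euc d → Ω → ℝ} {ν : Measure S} {V : Euc d → S → ℝ≥0∞}

theorem fddLaw_Iic (hX : ∀ t, Measurable (X t)) {m : ℕ} (t : Fin m → Euc d) (x : Fin m → ℝ) :
    fddLaw P X t (Iic x) = P {ω | ∀ k, X (t k) ω ≤ x k} := by
  rw [fddLaw, Measure.map_apply (measurable_pi_lambda _ fun k => hX (t k)) measurableSet_Iic]
  rfl

theorem isProbabilityMeasure_fddLaw [IsProbabilityMeasure P] (hX : ∀ t, Measurable (X t))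
    {m : ℕ} (t : Fin m → Euc d) : IsProbabilityMeasure (fddLaw P X t) :=
  Measure.isProbabilityMeasure_map (measurable_pi_lambda _ fun k => hX (t k)).aemeasurable

namespace HasSpectralRepresentation

variable (h : HasSpectralRepresentation P X ν V)
include h

theorem toReal_lintegral_iSup_div {m : ℕ} (t : Fin m → Euc d) {c : ℝ} (hc : 0 < c)
    (x : Fin m → ℝ) :
    (∫⁻ s, ⨆ k, V (t k) s / ENNReal.ofReal (c * x k) ∂ν).toReal =
      (∫⁻ s, ⨆ k, V (t k) s / ENNReal.ofReal (x k) ∂ν).toReal / c := by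
  have : ∀ s, ⨆ k, V (t k) s / ENNReal.ofReal (c * x k) =
      (⨆ k, V (t k) s / ENNReal.ofReal (x k)) * (ENNReal.ofReal c)⁻¹ := by
    intro s
    rw [ENNReal.iSup_mul]
    refine iSup_congr fun k => ?_
    rw [ENNReal.ofReal_mul hc.le, div_eq_mul_inv, div_eq_mul_inv,
      ENNReal.mul_inv (by simp) (by simp), mul_assoc, mul_comm (ENNReal.ofReal c)⁻¹]
  simp_rw [this]
  rw [lintegral_mul_const'' _
    (Measurable.iSup fun k => (h.measurable_spectral (t k)).div_const _).aemeasurable,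
    ENNReal.toReal_mul, ENNReal.toReal_inv, ENNReal.toReal_ofReal hc.le, div_eq_mul_inv]

theorem hasStdFrechetMargins : HasStdFrechetMargins P X := by
  intro t x hx
  have h1 := h.fdd 1 (fun _ => t) (fun _ => x) (fun _ => hx)
  simp only [ciSup_const, forall_const, div_eq_mul_inv] at h1
  rw [lintegral_mul_const _ (h.measurable_spectral t), h.lintegral_spectral, one_mul,
    ENNReal.toReal_inv, ENNReal.toReal_ofReal hx.le] at h1
  rw [h1, neg_div, one_div]

/-- Fréchet margins put no mass on `(-∞, 0]`. This covers the thresholds on which the distribution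
formula is silent, so that laws can be compared on all lower orthants. -/
theorem measure_forall_le_eq_zero {m : ℕ} (t : Fin m → Euc d) {x : Fin m → ℝ} {k : Fin m}
    (hk : x k ≤ 0) : P {ω | ∀ k, X (t k) ω ≤ x k} = 0 := by
  have hle : ∀ n : ℕ, P {ω | ∀ k, X (t k) ω ≤ x k} ≤
      ENNReal.ofReal (Real.exp (-(n + 1 : ℝ))) := by
    intro n
    have h1 := h.hasStdFrechetMargins (t k) (1 / (n + 1 : ℝ)) (by positivity)
    rw [show -1 / (1 / (n + 1 : ℝ)) = -(n + 1 : ℝ) by field_simp] at h1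
    rw [← h1]
    refine measure_mono fun ω hω => (hω k).trans (hk.trans (by positivity))
  have hlim : Tendsto (fun n : ℕ => ENNReal.ofReal (Real.exp (-(n + 1 : ℝ)))) atTop (𝓝 0) := by
    have : Tendsto (fun n : ℕ => Real.exp (-(n + 1 : ℝ))) atTop (𝓝 0) :=
      Real.tendsto_exp_neg_atTop_nhds_zero.comp
        (tendsto_atTop_add_const_right _ _ tendsto_natCast_atTop_atTop)
    simpa using ENNReal.tendsto_ofReal this
  exact le_antisymm (ge_of_tendsto' hlim hle) zero_le

theorem isStationary [IsProbabilityMeasure P] (hX : ∀ t, Measurable (X t))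
    (hinv : ∀ (m : ℕ) (t : Fin m → Euc d) (u : Euc d) (x : Fin m → ℝ), (∀ k, 0 < x k) →
      ∫⁻ s, ⨆ k, V (t k + u) s / ENNReal.ofReal (x k) ∂ν =
        ∫⁻ s, ⨆ k, V (t k) s / ENNReal.ofReal (x k) ∂ν) :
    IsStationaryProcess P X := by
  intro m t u
  have := isProbabilityMeasure_fddLaw (P := P) hX t
  have := isProbabilityMeasure_fddLaw (P := P) hX (fun k => t k + u)
  refine measure_pi_ext_of_Iic fun x => ?_
  rw [fddLaw_Iic hX, fddLaw_Iic hX]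
  by_cases hx : ∀ k, 0 < x k
  · rw [h.fdd m _ x hx, h.fdd m _ x hx, hinv m t u x hx]
  · push Not at hx
    obtain ⟨k, hk⟩ := hx
    rw [h.measure_forall_le_eq_zero t hk, h.measure_forall_le_eq_zero (fun k => t k + u) hk]

theorem isMaxStable [IsProbabilityMeasure P] (hX : ∀ t, Measurable (X t)) :
    IsMaxStableProcess P X := by
  intro m t n hn
  have hn0 : (0 : ℝ) < n := by exact_mod_cast hn
  have : Nonempty (Fin n) := ⟨⟨0, hn⟩⟩
  -- The exponent is homogeneous of degree `-1` in `x`, so the norming is `a = n`, `b = 0`.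
  refine ⟨fun _ => n, fun _ => 0, fun _ => hn0, ?_⟩
  have := isProbabilityMeasure_fddLaw (P := P) hX t
  have hm1 : Measurable fun (y : Fin n → Fin m → ℝ) k => ⨆ i, y i k :=
    measurable_pi_lambda _ fun k => Measurable.iSup fun i =>
      (measurable_pi_apply k).comp (measurable_pi_apply i)
  have hm2 : Measurable fun (y : Fin m → ℝ) k => (n : ℝ) * y k + 0 := by fun_prop
  have := Measure.isProbabilityMeasure_map (μ := Measure.pi fun _ : Fin n => fddLaw P X t)
    hm1.aemeasurable
  have := Measure.isProbabilityMeasure_map (μ := fddLaw P X t) hm2.aemeasurable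
  refine measure_pi_ext_of_Iic fun x => ?_
  rw [Measure.map_apply hm1 measurableSet_Iic, Measure.map_apply hm2 measurableSet_Iic]
  have h1 : (fun (y : Fin n → Fin m → ℝ) k => ⨆ i, y i k) ⁻¹' Iic x =
      univ.pi fun _ => Iic x := by
    ext y
    simp only [mem_preimage, mem_Iic, Pi.le_def, Set.mem_pi, mem_univ, true_imp_iff]
    rw [forall_comm]
    exact forall_congr' fun k => ciSup_le_iff (Set.finite_range _).bddAbove
  have h2 : (fun (y : Fin m → ℝ) k => (n : ℝ) * y k + 0) ⁻¹' Iic x =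
      Iic fun k => (n : ℝ)⁻¹ * x k := by
    ext y
    simp only [mem_preimage, mem_Iic, Pi.le_def, add_zero]
    exact forall_congr' fun k => (le_inv_mul_iff₀ hn0).symm
  rw [h1, h2, Measure.pi_pi, Finset.prod_const, Finset.card_univ, Fintype.card_fin,
    fddLaw_Iic hX, fddLaw_Iic hX]
  by_cases hx : ∀ k, 0 < x k
  · rw [h.fdd m t x hx, h.fdd m t _ fun k => mul_pos (inv_pos.2 hn0) (hx k),
      h.toReal_lintegral_iSup_div t (inv_pos.2 hn0) x,
      ← ENNReal.ofReal_pow (Real.exp_pos _).le, ← Real.exp_nat_mul]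
    congr 2
    field_simp
  · push Not at hx
    obtain ⟨k, hk⟩ := hx
    rw [h.measure_forall_le_eq_zero t hk, h.measure_forall_le_eq_zero t (k := k)
      (mul_nonpos_of_nonneg_of_nonpos (inv_nonneg.2 hn0.le) hk), zero_pow (by omega)]

/-- The TCF conditions on `τ ≤ X`, whose complement is a strict inequality; it is reached from the
non-strict formula along levels increasing to `τ`. -/
theorem measureReal_forall_lt {m : ℕ} (t : Fin m → Euc d) {τ : ℝ} (hτ : 0 < τ) :
    P.real {ω | ∀ k, X (t k) ω < τ} = Real.exp (-(∫⁻ s, ⨆ k, V (t k) s ∂ν).toReal / τ) := by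
  obtain ⟨u, hu, hut, hlim⟩ := exists_seq_strictMono_tendsto' hτ
  have hset : {ω | ∀ k, X (t k) ω < τ} = ⋃ n, {ω | ∀ k, X (t k) ω ≤ u n} := by
    ext ω
    simp only [mem_ofPred_eq, mem_iUnion]
    constructor
    · intro hω
      have : ∀ᶠ n in atTop, ∀ k, X (t k) ω < u n :=
        eventually_all.2 fun k => hlim.eventually_const_lt (hω k)
      obtain ⟨n, hn⟩ := this.exists
      exact ⟨n, fun k => (hn k).le⟩
    · rintro ⟨n, hn⟩ k
      exact (hn k).trans_lt (hut n).2
  have h1 : Tendsto (fun n => P {ω | ∀ k, X (t k) ω ≤ u n}) atTop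
      (𝓝 (P {ω | ∀ k, X (t k) ω < τ})) := by
    rw [hset]
    exact tendsto_measure_iUnion_atTop fun i j hij ω hω k => (hω k).trans (hu.monotone hij)
  have h2 : ∀ n, P {ω | ∀ k, X (t k) ω ≤ u n} =
      ENNReal.ofReal (Real.exp (-(∫⁻ s, ⨆ k, V (t k) s ∂ν).toReal / u n)) := by
    intro n
    have := h.toReal_lintegral_iSup_div t (hut n).1 fun _ => 1
    simp only [mul_one, ENNReal.ofReal_one, div_one] at this
    rw [h.fdd m t (fun _ => u n) fun _ => (hut n).1, this, neg_div]
  simp_rw [h2] at h1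
  have h3 : Tendsto (fun n => Real.exp (-(∫⁻ s, ⨆ k, V (t k) s ∂ν).toReal / u n)) atTop
      (𝓝 (Real.exp (-(∫⁻ s, ⨆ k, V (t k) s ∂ν).toReal / τ))) :=
    (Real.continuous_exp.tendsto _).comp (tendsto_const_nhds.div hlim hτ.ne')
  rw [measureReal_def, tendsto_nhds_unique h1 (ENNReal.tendsto_ofReal h3),
    ENNReal.toReal_ofReal (Real.exp_pos _).le]

theorem toReal_lintegral_max (s t : Euc d) :
    (∫⁻ z, max (V s z) (V t z) ∂ν).toReal = 2 - (∫⁻ z, min (V s z) (V t z) ∂ν).toReal := by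
  have h1 : ∫⁻ z, max (V s z) (V t z) ∂ν + ∫⁻ z, min (V s z) (V t z) ∂ν = 2 := by
    rw [← lintegral_add_right _ ((h.measurable_spectral s).min (h.measurable_spectral t))]
    simp_rw [max_add_min]
    rw [lintegral_add_left (h.measurable_spectral s), h.lintegral_spectral, h.lintegral_spectral,
      one_add_one_eq_two]
  have h2 := congrArg ENNReal.toReal h1
  rw [ENNReal.toReal_add] at h2
  · simp at h2; linarith
  · exact ne_top_of_le_ne_top (by simp) (le_self_add.trans h1.le)
  · exact ne_top_of_le_ne_top (by simp) (le_add_self.trans h1.le)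

end HasSpectralRepresentation

theorem tendsto_one_sub_exp_div (c : ℝ) :
    Tendsto (fun τ : ℝ => (1 - Real.exp (-c / τ)) * τ) atTop (𝓝 c) := by
  have hd : HasDerivAt (fun s : ℝ => 1 - Real.exp (-c * s)) c 0 := by
    have := (((hasDerivAt_id (0 : ℝ)).const_mul (-c)).exp).const_sub 1
    simpa using this
  have h1 := hd.tendsto_slope_zero_right
  have h2 := h1.comp tendsto_inv_atTop_nhdsGT_zero
  refine h2.congr fun τ => ?_
  simp [div_eq_mul_inv, mul_comm]

theorem tendsto_tail_ratio (c : ℝ) :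
    Tendsto (fun τ : ℝ => (1 - Real.exp (-1 / τ))⁻¹ *
      (1 - 2 * Real.exp (-1 / τ) + Real.exp (-(2 - c) / τ))) atTop (𝓝 c) := by
  -- The ratio equals `2 - (1 - exp (-(2 - c) / τ)) / (1 - exp (-1 / τ))`, and the quotient tends to
  -- `2 - c`.
  have h := (tendsto_one_sub_exp_div (2 - c)).div (tendsto_one_sub_exp_div 1) one_ne_zero
  have h' := h.const_sub 2
  rw [div_one, sub_sub_cancel] at h'
  refine h'.congr' ?_
  filter_upwards [eventually_gt_atTop 0] with τ hτ
  have : 1 - Real.exp (-1 / τ) ≠ 0 := by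
    have : Real.exp (-1 / τ) < 1 := Real.exp_lt_one_iff.2 (div_neg_of_neg_of_pos (by norm_num) hτ)
    linarith
  simp only [Pi.div_apply]
  rw [mul_div_mul_right _ _ hτ.ne', inv_mul_eq_div, eq_div_iff this, sub_mul, div_mul_cancel₀ _ this]
  ring

theorem HasSpectralRepresentation.hasTCF (h : HasSpectralRepresentation P X ν V)
    [IsProbabilityMeasure P] (hX : ∀ t, Measurable (X t)) :
    HasTCF P X fun t => (∫⁻ s, min (V 0 s) (V t s) ∂ν).toReal := by
  intro t
  refine (tendsto_tail_ratio _).congr' ?_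
  filter_upwards [eventually_gt_atTop 0] with τ hτ
  have hmarg : ∀ t, P.real {ω | X t ω < τ} = Real.exp (-1 / τ) := by
    intro t
    have := h.measureReal_forall_lt (fun _ : Fin 1 => t) hτ
    simpa [h.lintegral_spectral] using this
  have hpair : P.real ({ω | X 0 ω < τ} ∩ {ω | X t ω < τ}) =
      Real.exp (-(2 - (∫⁻ s, min (V 0 s) (V t s) ∂ν).toReal) / τ) := by
    have := h.measureReal_forall_lt ![0, t] hτ
    have hsup : ∀ s, ⨆ k, V (![0, t] k) s = max (V 0 s) (V t s) := fun s => by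
      refine le_antisymm (iSup_le fun k => ?_) (max_le ?_ ?_)
      · fin_cases k <;> simp
      · exact le_iSup (fun k => V (![0, t] k) s) 0
      · exact le_iSup (fun k => V (![0, t] k) s) 1
    simp_rw [hsup, h.toReal_lintegral_max] at this
    rw [← this]
    congr 1
    ext ω
    simp [Fin.forall_fin_two]
  have hm : ∀ t, MeasurableSet {ω | X t ω < τ} := fun t => hX t measurableSet_Iio
  have hc : ∀ t, {ω | τ ≤ X t ω} = {ω | X t ω < τ}ᶜ := fun t => by ext; simp
  rw [hc, hc, measureReal_def, cond_apply (hm 0).compl, ENNReal.toReal_mul, ENNReal.toReal_inv,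
    ← measureReal_def, ← measureReal_def, ← compl_union, probReal_compl_eq_one_sub (hm 0),
    probReal_compl_eq_one_sub ((hm 0).union (hm t)), hmarg]
  have := measureReal_union_add_inter (μ := P) (s := {ω | X 0 ω < τ}) (hm t)
  rw [hpair, hmarg, hmarg] at this
  congr 1
  linarith

theorem tcfSet_of_spectral (ν : Measure S) [SFinite ν] (hV : ∀ t, Measurable (V t))
    (hV1 : ∀ t, ∫⁻ s, V t s ∂ν = 1)
    (hinv : ∀ (m : ℕ) (t : Fin m → Euc d) (u : Euc d) (x : Fin m → ℝ), (∀ k, 0 < x k) →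
      ∫⁻ s, ⨆ k, V (t k + u) s / ENNReal.ofReal (x k) ∂ν =
        ∫⁻ s, ⨆ k, V (t k) s / ENNReal.ofReal (x k) ∂ν) :
    (fun t => (∫⁻ s, min (V 0 s) (V t s) ∂ν).toReal) ∈ tcfSet d := by
  obtain ⟨Ω, mΩ, P, X, hP, hX, h⟩ := exists_hasSpectralRepresentation ν hV hV1
  exact ⟨Ω, mΩ, P, X, hP, hX, h.isStationary hX hinv, h.isMaxStable hX,
    h.hasStdFrechetMargins, h.hasTCF hX⟩

end Spectral

/-! ### The obstruction to M3r in dimension at least two -/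

/-- `u - z` is the midpoint of `-z` and `2u - z`, and the norm is convex. -/
theorem norm_sub_le_max_norm {E : Type*} [NormedAddCommGroup E] [NormedSpace ℝ E] (u z : E) :
    ‖u - z‖ ≤ max ‖z‖ ‖(2 : ℝ) • u - z‖ := by
  have h : (2 : ℝ) • (u - z) = ((2 : ℝ) • u - z) - z := by rw [smul_sub, two_smul ℝ z]; abel
  have h1 : 2 * ‖u - z‖ ≤ ‖(2 : ℝ) • u - z‖ + ‖z‖ := by
    calc 2 * ‖u - z‖ = ‖(2 : ℝ) • (u - z)‖ := by rw [norm_smul]; norm_num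
      _ ≤ _ := by rw [h]; exact norm_sub_le _ _
  rcases le_total ‖z‖ ‖(2 : ℝ) • u - z‖ with h2 | h2
  · rw [max_eq_right h2]; linarith
  · rw [max_eq_left h2]; linarith

/-- A radially non-increasing function that satisfies `g (u - z) ≤ max (g (-z)) (g (2u - z))`
for almost all `z` is constant off the origin: otherwise a radius at which `g` drops
produces an open set of exceptional points `z`, with `u - z` almost orthogonal to `u`. -/
theorem radial_const_of_ae_le_max {E : Type*} [NormedAddCommGroup E] [InnerProductSpace ℝ E]
    [MeasurableSpace E] (μ : Measure E) [μ.IsOpenPosMeasure] {g : E → ℝ≥0∞}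
    (hg : ∀ s t, ‖s‖ ≤ ‖t‖ → g t ≤ g s) {u v : E} (hu : u ≠ 0) (hv : ‖v‖ = 1)
    (huv : inner ℝ u v = 0)
    (h : ∀ᵐ z ∂μ, g (u - z) ≤ max (g (-z)) (g ((2 : ℝ) • u - z))) {x y : E} (hx : x ≠ 0)
    (hy : y ≠ 0) : g x = g y := by
  wlog hlt : g y < g x generalizing x y
  · by_contra hne
    exact hne (this hy hx (lt_of_le_of_ne (not_lt.1 hlt) hne)).symm
  exfalso
  -- The supremum `R` of these radii is where `g` falls below the level `g x`; it is finite because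
  -- `g y` is already lower.
  set A : Set ℝ := {r | ∃ w, ‖w‖ = r ∧ g x ≤ g w}
  have hA : BddAbove A := by
    refine ⟨‖y‖, ?_⟩
    rintro _ ⟨w, rfl, hw⟩
    by_contra! hc
    exact (hw.trans (hg _ _ hc.le)).not_gt hlt
  set R := sSup A
  have hxR : ‖x‖ ≤ R := le_csSup hA ⟨x, rfl, le_rfl⟩
  have hR : 0 < R := (norm_pos_iff.2 hx).trans_le hxR
  have hin : ∀ w, ‖w‖ < R → g x ≤ g w := fun w hw => by
    obtain ⟨_, ⟨w', rfl, hw'⟩, hlt'⟩ := exists_lt_of_lt_csSup (s := A) ⟨‖x‖, x, rfl, le_rfl⟩ hw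
    exact hw'.trans (hg _ _ hlt'.le)
  have hout : ∀ w, R < ‖w‖ → g w < g x := fun w hw => by
    by_contra! hc
    exact hw.not_ge (le_csSup hA ⟨w, rfl, hc⟩)
  let U : Set E := {z | ‖u - z‖ < R} ∩ ({z | R < ‖z‖} ∩ {z | R < ‖(2 : ℝ) • u - z‖})
  have hUo : IsOpen U :=
    (isOpen_lt (by fun_prop) (by fun_prop)).inter
      ((isOpen_lt (by fun_prop) (by fun_prop)).inter (isOpen_lt (by fun_prop) (by fun_prop)))
  have hUne : U.Nonempty := by
    have hu2 : 0 < ‖u‖ ^ 2 := by positivity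
    -- The witness is `z = u - √q • v`: then `‖u - z‖² = q < R²`, whereas by orthogonality `‖z‖² =
    -- ‖2u - z‖² = ‖u‖² + q > R²`.
    obtain ⟨q, hq1, hq2⟩ := exists_between
      (max_lt (by positivity : (0 : ℝ) < R ^ 2) (by linarith : R ^ 2 - ‖u‖ ^ 2 < R ^ 2))
    have hq0 := (le_max_left _ _).trans hq1.le
    have hqu := (le_max_right _ _).trans_lt hq1
    have hsq : √q ^ 2 = q := Real.sq_sqrt hq0
    have hnorm : ‖√q • v‖ ^ 2 = q := by
      rw [norm_smul, hv, mul_one, Real.norm_of_nonneg (Real.sqrt_nonneg q), hsq]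
    have hinner : inner ℝ u (√q • v) = 0 := by rw [inner_smul_right, huv, mul_zero]
    refine ⟨u - √q • v, ?_, ?_, ?_⟩
    · simp only [mem_ofPred_eq, sub_sub_cancel]
      exact lt_of_pow_lt_pow_left₀ 2 hR.le (by rw [hnorm]; exact hq2)
    · refine lt_of_pow_lt_pow_left₀ 2 (norm_nonneg _) ?_
      rw [norm_sub_sq_real, hinner, hnorm]; linarith
    · refine lt_of_pow_lt_pow_left₀ 2 (norm_nonneg _) ?_
      rw [show (2 : ℝ) • u - (u - √q • v) = u + √q • v by rw [two_smul]; abel,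
        norm_add_sq_real, hinner, hnorm]
      linarith
  refine (hUo.measure_pos μ hUne).ne' (measure_mono_null ?_ h)
  rintro z ⟨h1, h2, h3⟩ hz
  exact (lt_of_le_of_lt ((hin _ h1).trans hz)
    (max_lt (hout _ (by rwa [norm_neg])) (hout _ h3))).false

theorem ENNReal.min_add_min_le {a b c : ℝ≥0∞} (h : min a b ≤ c) :
    min a c + min c b ≤ c + min a b := by
  rcases le_total a b with hab | hab
  · rw [min_eq_left hab] at h ⊢
    rw [min_eq_left h, add_comm]
    gcongr; exact min_le_left _ _
  · rw [min_eq_right hab] at h ⊢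
    rw [min_eq_right h]
    gcongr; exact min_le_right _ _

/-- Cancelling the smaller of `a` and `b`, which is finite, leaves the statement that the minimum of
`c` with the larger one is `c`. -/
theorem ENNReal.le_max_of_min_add_min_eq {a b c : ℝ≥0∞} (h : min a b ≤ c) (hc : c ≠ ∞)
    (heq : min a c + min c b = c + min a b) : c ≤ max a b := by
  have hfin : min a b ≠ ∞ := ne_top_of_le_ne_top hc h
  rcases le_total a b with hab | hab
  · rw [min_eq_left hab] at h heq hfin
    rw [min_eq_left h, add_comm, ENNReal.add_left_inj hfin] at heq
    exact (min_eq_left_iff.1 heq).trans (le_max_right _ _)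
  · rw [min_eq_right hab] at h heq hfin
    rw [min_eq_right h, ENNReal.add_left_inj hfin] at heq
    exact (min_eq_right_iff.1 heq).trans (le_max_left _ _)

/-- In dimension `k ≥ 2`, the TCF of an M3r process has a non-vanishing second difference. -/
theorem radialFun_notMem_tcfM3r {k : ℕ} (hk : 2 ≤ k) {φ : ℝ → ℝ}
    (hφ : φ 0 - 2 * φ (1 / 2) + φ 1 = 0) : radialFun k φ ∉ tcfM3r k := by
  rintro ⟨Ω, _, P, X, hP, hX, ⟨F, _, Q, f, hf, h⟩, hχ⟩
  have hQ := hf.isProbabilityMeasure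
  set V : Euc k → Euc k × F → ℝ≥0∞ := fun t s => f s.2 (t - s.1) with hV
  set ν := (volume : Measure (Euc k)).prod Q
  have hVm := h.measurable_spectral
  have hχ' : ∀ t, φ ‖t‖ = (∫⁻ s, min (V 0 s) (V t s) ∂ν).toReal := fun t =>
    tendsto_nhds_unique (hχ t) (h.hasTCF hX t)
  set u : Euc k := EuclideanSpace.single ⟨0, by omega⟩ (1 / 2 : ℝ) with hu_def
  set v : Euc k := EuclideanSpace.single ⟨1, by omega⟩ (1 : ℝ) with hv_def
  have hun : ‖u‖ = 1 / 2 := by rw [hu_def, PiLp.norm_single]; norm_num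
  have hvn : ‖v‖ = 1 := by rw [hv_def, PiLp.norm_single]; norm_num
  have huv : inner ℝ u v = 0 := by
    rw [hu_def, hv_def, EuclideanSpace.inner_single_left]; simp
  have hu0 : u ≠ 0 := by rw [← norm_pos_iff, hun]; norm_num
  have hv0 : v ≠ 0 := by rw [← norm_pos_iff, hvn]; norm_num
  have hfin : ∀ s t, ∫⁻ z, min (V s z) (V t z) ∂ν ≠ ∞ := fun s t =>
    ne_top_of_le_ne_top (by rw [h.lintegral_spectral s]; exact ENNReal.one_ne_top)
      (lintegral_mono fun z => min_le_left _ _)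
  have hshift : ∫⁻ z, min (V u z) (V ((2 : ℝ) • u) z) ∂ν = ∫⁻ z, min (V 0 z) (V u z) ∂ν := by
    rw [lintegral_prod_symm' _ ((hVm _).min (hVm _)), lintegral_prod_symm' _ ((hVm _).min (hVm _))]
    refine lintegral_congr fun ω => ?_
    rw [← lintegral_add_right_eq_self _ u]
    refine lintegral_congr fun z => ?_
    simp only [hV]
    congr 2
    · abel
    · rw [two_smul]; abel
  have hquasi : ∀ z, min (V 0 z) (V ((2 : ℝ) • u) z) ≤ V u z := by
    intro z
    rcases le_max_iff.1 (norm_sub_le_max_norm u z.1) with h1 | h1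
    · exact (min_le_left _ _).trans (hf.radial_antitone _ _ _ (by rwa [zero_sub, norm_neg]))
    · exact (min_le_right _ _).trans (hf.radial_antitone _ _ _ h1)
  -- In terms of the TCF this reads `1 + φ 1 = 2 φ (1/2)`, which is the hypothesis because `φ 0 =
  -- 1`.
  have heq : ∫⁻ z, (V u z + min (V 0 z) (V ((2 : ℝ) • u) z)) ∂ν =
      ∫⁻ z, (min (V 0 z) (V u z) + min (V u z) (V ((2 : ℝ) • u) z)) ∂ν := by
    rw [lintegral_add_left (hVm _), lintegral_add_left ((hVm _).min (hVm _)), hshift,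
      h.lintegral_spectral, ← ENNReal.toReal_eq_toReal_iff'
        (ENNReal.add_ne_top.2 ⟨ENNReal.one_ne_top, hfin _ _⟩)
        (ENNReal.add_ne_top.2 ⟨hfin _ _, hfin _ _⟩),
      ENNReal.toReal_add ENNReal.one_ne_top (hfin _ _), ENNReal.toReal_add (hfin _ _) (hfin _ _),
      ← hχ', ← hχ', hun, norm_smul, hun]
    have h0 : φ 0 = 1 := by
      have := hχ' 0
      simpa [h.lintegral_spectral] using this
    norm_num at hφ ⊢
    linarith
  have hae : ∀ᵐ z ∂ν, V u z ≤ max (V 0 z) (V ((2 : ℝ) • u) z) := by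
    have h1 := ae_eq_of_ae_le_of_lintegral_le
      (Eventually.of_forall fun z => ENNReal.min_add_min_le (hquasi z))
      (by rw [← heq, lintegral_add_left (hVm _), h.lintegral_spectral]
          exact ENNReal.add_ne_top.2 ⟨ENNReal.one_ne_top, hfin _ _⟩)
      ((hVm _).add ((hVm _).min (hVm _))).aemeasurable heq.le
    filter_upwards [h1, ae_lt_top (hVm u) (by simp [h.lintegral_spectral u])] with z hz hz'
    exact ENNReal.le_max_of_min_add_min_eq (hquasi z) hz'.ne hz
  have hae' : ∀ᵐ ω ∂Q, ∀ᵐ z : Euc k, f ω (u - z) ≤ max (f ω (-z)) (f ω ((2 : ℝ) • u - z)) := by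
    have := (Measure.measurePreserving_swap (μ := Q)
      (ν := (volume : Measure (Euc k)))).quasiMeasurePreserving.ae hae
    simpa [hV] using Measure.ae_ae_of_ae_prod this
  have hint : ∀ᵐ ω ∂Q, ∫⁻ t, f ω t < ∞ :=
    ae_lt_top hf.measurable.lintegral_prod_right' (by rw [hf.lintegral_eq_one]; simp)
  -- Almost every shape is constant off the origin and has a finite integral over a space of
  -- infinite volume, so the constant is zero.
  have hzero : ∀ᵐ ω ∂Q, ∫⁻ t, f ω t = 0 := by
    filter_upwards [hae', hint] with ω h1 h2
    have : Nontrivial (Euc k) := ⟨v, 0, hv0⟩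
    have : NoncompactSpace (Euc k) := NormedSpace.noncompactSpace ℝ (Euc k)
    have h3 : f ω =ᵐ[volume] fun _ => f ω v := by
      filter_upwards [Measure.ae_ne volume (0 : Euc k)] with t ht
      exact radial_const_of_ae_le_max volume (hf.radial_antitone ω) hu0 hvn huv h1 ht hv0
    rw [lintegral_congr_ae h3, lintegral_const] at h2 ⊢
    rcases eq_or_ne (f ω v) 0 with h4 | h4
    · rw [h4, zero_mul]
    · rw [measure_univ_of_isAddLeftInvariant, ENNReal.mul_top h4] at h2
      exact absurd h2 (lt_irrefl _)
  have := hf.lintegral_eq_one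
  rw [lintegral_congr_ae hzero] at this
  simp at this

/-! ### Rotation invariance of turning bands and the uniform distribution on the sphere -/

section Sphere

open scoped Pointwise in
-- The surface measure of a set is, up to a factor, the volume of the cone over it, and a linear
-- isometry carries cones to cones.
theorem measurePreserving_toSphere {E : Type*} [NormedAddCommGroup E] [NormedSpace ℝ E]
    [MeasurableSpace E] [BorelSpace E] {μ : Measure E} (L : E ≃ₗᵢ[ℝ] E)
    (hL : MeasurePreserving L μ μ) :
    MeasurePreserving (fun a : Metric.sphere (0 : E) 1 =>
      (⟨L a, by simp⟩ : Metric.sphere (0 : E) 1)) μ.toSphere μ.toSphere := by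
  have hm : Measurable (fun a : Metric.sphere (0 : E) 1 =>
      (⟨L a, by simp⟩ : Metric.sphere (0 : E) 1)) :=
    (L.continuous.measurable.comp measurable_subtype_coe).subtype_mk
  refine ⟨hm, ?_⟩
  ext s hs
  rw [Measure.map_apply hm hs, Measure.toSphere_apply' _ (hm hs), Measure.toSphere_apply' _ hs]
  congr 1
  refine Eq.trans ?_ (hL.measure_preimage_equiv (f := L.toHomeomorph.toMeasurableEquiv) _)
  congr 1
  ext x
  simp only [Set.mem_smul, mem_preimage]
  constructor
  · rintro ⟨r, hr, _, ⟨a, ha, rfl⟩, rfl⟩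
    exact ⟨r, hr, _, ⟨_, ha, rfl⟩, (L.map_smul r a.1).symm⟩
  · rintro ⟨r, hr, _, ⟨a, ha, rfl⟩, hx⟩
    refine ⟨r, hr, _, ⟨⟨L.symm a, by simp⟩, by simpa using ha, rfl⟩, ?_⟩
    apply L.injective
    rw [L.map_smul, L.apply_symm_apply]
    exact hx

variable {d : ℕ}

theorem turningBandsOne_map_isometry (f : ℝ → ℝ) (L : Euc d ≃ₗᵢ[ℝ] Euc d) (t : Euc d) :
    turningBandsOne d f (L t) = turningBandsOne d f t := by
  have hmp := measurePreserving_toSphere (μ := (volume : Measure (Euc d))) L.symm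
    L.symm.measurePreserving
  have he : MeasurableEmbedding (fun a : Metric.sphere (0 : Euc d) 1 =>
      (⟨L.symm a, by simp⟩ : Metric.sphere (0 : Euc d) 1)) := by
    refine Topology.IsClosedEmbedding.measurableEmbedding (Continuous.isClosedEmbedding
      ((L.symm.continuous.comp continuous_subtype_val).subtype_mk _) fun a b hab => ?_)
    exact Subtype.ext (L.symm.injective (congrArg Subtype.val hab))
  unfold turningBandsOne
  rw [average_eq, average_eq]
  congr 1
  refine Eq.trans ?_ (hmp.integral_comp he fun a => f (inner ℝ (a : Euc d) t))
  refine integral_congr_ae (Eventually.of_forall fun a => ?_)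
  simp only
  rw [← L.inner_map_map (L.symm a) t, L.apply_symm_apply]

/-- The reflection in the hyperplane orthogonal to `s - t` exchanges two points of equal norm. -/
theorem turningBandsOne_eq_of_norm_eq (f : ℝ → ℝ) {s t : Euc d} (h : ‖s‖ = ‖t‖) :
    turningBandsOne d f s = turningBandsOne d f t := by
  have := turningBandsOne_map_isometry f (Submodule.reflection (Submodule.span ℝ {s - t})ᗮ) s
  rwa [Submodule.reflection_sub h, eq_comm] at this

variable (d)

/-- The uniform distribution on the unit sphere. -/
noncomputable def uniformSphere : Measure (Metric.sphere (0 : Euc d) 1) :=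
  ((volume : Measure (Euc d)).toSphere univ)⁻¹ • (volume : Measure (Euc d)).toSphere

theorem turningBandsOne_eq_integral (f : ℝ → ℝ) (t : Euc d) :
    turningBandsOne d f t = ∫ a, f (inner ℝ (a : Euc d) t) ∂uniformSphere d := rfl

variable [NeZero d]

theorem turningBandsOne_tent_eq_radialFun :
    turningBandsOne d tent = radialFun d (tentTB d) := by
  ext t
  exact turningBandsOne_eq_of_norm_eq tent (by simp [PiLp.norm_single])

instance isProbabilityMeasure_uniformSphere : IsProbabilityMeasure (uniformSphere d) := by
  have : NeZero (volume : Measure (Euc d)).toSphere := ⟨Measure.toSphere_ne_zero _⟩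
  unfold uniformSphere
  infer_instance

theorem tentTB_eq_integral (r : ℝ) :
    tentTB d r = ∫ a, tent ((a : Euc d) 0 * r) ∂uniformSphere d := by
  unfold tentTB
  rw [turningBandsOne_eq_integral]
  simp [EuclideanSpace.inner_single_right, mul_comm]

/-- The cone over the equator lies in a proper subspace, hence is null. This yields the decay of the
profile at infinity and makes the interval length `1 / |a 0|` meaningful. -/
theorem ae_uniformSphere_coord_ne_zero :
    ∀ᵐ a : Metric.sphere (0 : Euc d) 1 ∂uniformSphere d, (a : Euc d) 0 ≠ 0 := by
  refine Measure.ae_smul_measure ?_ _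
  have hms : MeasurableSet {a : Metric.sphere (0 : Euc d) 1 | (a : Euc d) 0 = 0} := by
    refine (isClosed_eq ?_ continuous_const).measurableSet
    fun_prop
  have hker : (volume : Measure (Euc d))
      (LinearMap.ker (EuclideanSpace.proj (𝕜 := ℝ) (0 : Fin d)).toLinearMap) = 0 := by
    refine Measure.addHaar_submodule _ _ fun h => ?_
    have h1 : EuclideanSpace.single (0 : Fin d) (1 : ℝ) ∈
      LinearMap.ker (EuclideanSpace.proj (𝕜 := ℝ) (0 : Fin d)).toLinearMap := h ▸ trivial
    simp at h1
  rw [ae_iff]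
  simp only [ne_eq, not_not]
  rw [Measure.toSphere_apply' _ hms]
  refine mul_eq_zero_of_right _ (measure_mono_null ?_ hker)
  rintro _ ⟨r, _, _, ⟨a, ha, rfl⟩, rfl⟩
  have ha' : (a : Euc d) 0 = 0 := ha
  simp [ha']

end Sphere

/-! ### Analytic properties of the profile -/

section Tent

theorem tent_nonneg (s : ℝ) : 0 ≤ tent s := le_max_right _ _

theorem tent_le_one (s : ℝ) : tent s ≤ 1 := max_le (by linarith [abs_nonneg s]) zero_le_one

theorem continuous_tent : Continuous tent := by unfold tent; fun_prop

theorem tent_mul_eq_of_le_one {a r : ℝ} (ha : |a| ≤ 1) (h0 : 0 ≤ r) (h1 : r ≤ 1) :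
    tent (a * r) = 1 - |a| * r := by
  rw [tent, abs_mul, abs_of_nonneg h0, max_eq_left]
  nlinarith [abs_nonneg a]

theorem convexOn_tent_mul (a : ℝ) : ConvexOn ℝ (Ici 0) fun r => tent (a * r) := by
  have h1 : ConvexOn ℝ (Ici (0 : ℝ)) fun r => 1 - |a| * r :=
    ⟨convex_Ici 0, fun x _ y _ p q _ _ hpq => by
      simp only [smul_eq_mul]
      nlinarith⟩
  refine (h1.sup (convexOn_const 0 (convex_Ici 0))).congr fun r hr => ?_
  simp only [Pi.sup_apply, tent, abs_mul, abs_of_nonneg (mem_Ici.1 hr)]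

theorem tendsto_tent_mul {a : ℝ} (ha : a ≠ 0) :
    Tendsto (fun r => tent (a * r)) atTop (𝓝 0) := by
  refine tendsto_const_nhds.congr' ?_
  filter_upwards [eventually_ge_atTop (1 / |a|)] with r hr
  have hr0 : 0 ≤ r := (by positivity : (0 : ℝ) ≤ 1 / |a|).trans hr
  rw [div_le_iff₀ (abs_pos.2 ha)] at hr
  rw [tent, abs_mul, abs_of_nonneg hr0, max_eq_right]
  linarith

variable (d : ℕ)

variable [NeZero d]

theorem continuous_sphere_coord_mul (r : ℝ) :
    Continuous fun a : Metric.sphere (0 : Euc d) 1 => (a : Euc d) 0 * r := by fun_prop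

theorem aestronglyMeasurable_tent_coord_mul (r : ℝ) :
    AEStronglyMeasurable (fun a : Metric.sphere (0 : Euc d) 1 => tent ((a : Euc d) 0 * r))
      (uniformSphere d) :=
  (continuous_tent.comp (continuous_sphere_coord_mul d r)).aestronglyMeasurable

theorem integrable_tent_coord_mul (r : ℝ) :
    Integrable (fun a : Metric.sphere (0 : Euc d) 1 => tent ((a : Euc d) 0 * r))
      (uniformSphere d) :=
  (integrable_const (1 : ℝ)).mono' (aestronglyMeasurable_tent_coord_mul d r)
    (Eventually.of_forall fun a => by
      rw [Real.norm_of_nonneg (tent_nonneg _)]; exact tent_le_one _)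

theorem continuous_tentTB : Continuous (tentTB d) := by
  simp_rw [funext (tentTB_eq_integral d)]
  refine continuous_of_dominated (bound := fun _ => 1) (aestronglyMeasurable_tent_coord_mul d)
    (fun r => Eventually.of_forall fun a => ?_) (integrable_const _)
    (Eventually.of_forall fun a => ?_)
  · rw [Real.norm_of_nonneg (tent_nonneg _)]; exact tent_le_one _
  · exact continuous_tent.comp (continuous_const.mul continuous_id)

theorem tendsto_tentTB_atTop : Tendsto (tentTB d) atTop (𝓝 0) := by
  simp_rw [funext (tentTB_eq_integral d)]
  have := tendsto_integral_filter_of_dominated_convergence (μ := uniformSphere d) (l := atTop)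
    (F := fun r (a : Metric.sphere (0 : Euc d) 1) => tent ((a : Euc d) 0 * r)) (f := fun _ => 0)
    (fun _ => 1)
    (Eventually.of_forall (aestronglyMeasurable_tent_coord_mul d))
    (Eventually.of_forall fun r => Eventually.of_forall fun a => by
      rw [Real.norm_of_nonneg (tent_nonneg _)]; exact tent_le_one _)
    (integrable_const _)
    ((ae_uniformSphere_coord_ne_zero d).mono fun a ha => tendsto_tent_mul ha)
  simpa using this

theorem convexOn_tentTB : ConvexOn ℝ (Ici 0) (tentTB d) := by
  refine ⟨convex_Ici 0, fun x hx y hy p q hp hq hpq => ?_⟩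
  simp_rw [tentTB_eq_integral, smul_eq_mul, ← integral_const_mul]
  rw [← integral_add ((integrable_tent_coord_mul d x).const_mul p)
    ((integrable_tent_coord_mul d y).const_mul q)]
  exact integral_mono (integrable_tent_coord_mul d _)
    (((integrable_tent_coord_mul d x).const_mul p).add
      ((integrable_tent_coord_mul d y).const_mul q))
    fun a => (convexOn_tent_mul ((a : Euc d) 0)).2 hx hy hp hq hpq

/-- For `|a 0| ≤ 1` the kink of `r ↦ tent (a 0 * r)` is not inside `[0,1]`, so each integrand is
affine there. -/
theorem tentTB_second_difference : tentTB d 0 - 2 * tentTB d (1 / 2) + tentTB d 1 = 0 := by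
  simp_rw [tentTB_eq_integral]
  have h1 := integral_add
    ((integrable_tent_coord_mul d 0).sub ((integrable_tent_coord_mul d (1 / 2)).const_mul 2))
    (integrable_tent_coord_mul d 1)
  have h2 := integral_sub (integrable_tent_coord_mul d 0)
    ((integrable_tent_coord_mul d (1 / 2)).const_mul 2)
  simp only [Pi.sub_apply] at h1
  rw [← integral_const_mul, ← h2, ← h1]
  refine integral_eq_zero_of_ae (Eventually.of_forall fun a => ?_)
  have ha : |(a : Euc d) 0| ≤ 1 := by
    have h1 := PiLp.norm_apply_le (a : Euc d) 0
    rwa [norm_eq_of_mem_sphere a, Real.norm_eq_abs] at h1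
  simp only [Pi.zero_apply]
  rw [tent_mul_eq_of_le_one ha le_rfl zero_le_one,
    tent_mul_eq_of_le_one ha (by norm_num) (by norm_num),
    tent_mul_eq_of_le_one ha zero_le_one le_rfl]
  ring

end Tent

/-! ### The band process on `ℝ^d` -/

theorem volume_abs_sub_le_inter (b c h : ℝ) :
    volume {z : ℝ | |b - z| ≤ h ∧ |c - z| ≤ h} = ENNReal.ofReal (2 * h - |b - c|) := by
  have hset : {z : ℝ | |b - z| ≤ h ∧ |c - z| ≤ h} = Icc (max b c - h) (min b c + h) := by
    ext z
    have h1 : max b c - h ≤ z ↔ b ≤ z + h ∧ c ≤ z + h := by rw [sub_le_iff_le_add, max_le_iff]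
    have h2 : z ≤ min b c + h ↔ z - h ≤ b ∧ z - h ≤ c := by rw [← sub_le_iff_le_add, le_min_iff]
    rw [mem_ofPred_eq, mem_Icc, abs_le, abs_le, h1, h2]
    constructor
    · rintro ⟨⟨h1, h2⟩, h3, h4⟩
      refine ⟨⟨?_, ?_⟩, ?_, ?_⟩ <;> linarith
    · rintro ⟨⟨h1, h2⟩, h3, h4⟩
      refine ⟨⟨?_, ?_⟩, ?_, ?_⟩ <;> linarith
  rw [hset, Real.volume_Icc]
  congr 1
  rw [← max_sub_min_eq_abs, max_comm c, min_comm c]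
  ring

theorem volume_abs_sub_le (c h : ℝ) : volume {z : ℝ | |c - z| ≤ h} = ENNReal.ofReal (2 * h) := by
  simpa using volume_abs_sub_le_inter c c h

theorem toReal_lintegral_ofReal_tent {A : Type*} [MeasurableSpace A] {Q : Measure A} {g : A → ℝ}
    (hg : Measurable g) :
    (∫⁻ a, ENNReal.ofReal (tent (g a)) ∂Q).toReal = ∫ a, tent (g a) ∂Q :=
  (integral_eq_lintegral_of_nonneg_ae (Eventually.of_forall fun _ => tent_nonneg _)
    (continuous_tent.measurable.comp hg).aestronglyMeasurable).symm

theorem ofReal_tent (s : ℝ) : ENNReal.ofReal (tent s) = ENNReal.ofReal (1 - |s|) := by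
  rw [tent, ENNReal.ofReal_max, ENNReal.ofReal_zero, max_eq_left zero_le]

theorem min_ite_zero {p q : Prop} [Decidable p] [Decidable q] (c : ℝ≥0∞) :
    min (if p then c else 0) (if q then c else 0) = if p ∧ q then c else 0 := by
  by_cases p <;> by_cases q <;> simp [*]

section TurningBands

variable (d : ℕ)

/-- Indicators of the bands of width `1` in `ℝ^d`, parametrized by direction and offset. -/
noncomputable def bandFun (t : Euc d) (s : Metric.sphere (0 : Euc d) 1 × ℝ) : ℝ≥0∞ :=
  {z : ℝ | |inner ℝ (s.1 : Euc d) t - z| ≤ 1 / 2}.indicator 1 s.2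

theorem measurable_bandFun (t : Euc d) : Measurable (bandFun d t) := by
  have : bandFun d t = {s : Metric.sphere (0 : Euc d) 1 × ℝ |
      |inner ℝ (s.1 : Euc d) t - s.2| ≤ 1 / 2}.indicator 1 := rfl
  rw [this]
  exact measurable_one.indicator (isClosed_le (by fun_prop) continuous_const).measurableSet

theorem measurableSet_abs_sub_le (c h : ℝ) : MeasurableSet {z : ℝ | |c - z| ≤ h} :=
  (isClosed_le (by fun_prop) continuous_const).measurableSet

variable [NeZero d]

theorem turningBandsOne_tent_mem_tcfSet : turningBandsOne d tent ∈ tcfSet d := by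
  have h := tcfSet_of_spectral (V := bandFun d) ((uniformSphere d).prod volume)
    (measurable_bandFun d) ?_ ?_
  · convert! h using 1
    ext t
    rw [lintegral_prod _ ((measurable_bandFun d 0).min (measurable_bandFun d t)).aemeasurable,
      turningBandsOne_eq_integral, ← toReal_lintegral_ofReal_tent (by fun_prop)]
    congr 1
    refine lintegral_congr fun a => ?_
    have : ∀ z, min (bandFun d 0 (a, z)) (bandFun d t (a, z)) =
        {z : ℝ | |0 - z| ≤ 1 / 2 ∧ |inner ℝ (a : Euc d) t - z| ≤ 1 / 2}.indicator 1 z := fun z => by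
      simp only [bandFun, indicator_apply, mem_ofPred_eq, inner_zero_right]
      exact min_ite_zero 1
    simp_rw [this]
    have hm : MeasurableSet {z : ℝ | |0 - z| ≤ 1 / 2 ∧ |inner ℝ (a : Euc d) t - z| ≤ 1 / 2} :=
      (measurableSet_abs_sub_le _ _).inter (measurableSet_abs_sub_le _ _)
    rw [lintegral_indicator_one hm,
      volume_abs_sub_le_inter, ofReal_tent]
    norm_num
  · intro t
    rw [lintegral_prod _ (measurable_bandFun d t).aemeasurable]
    have : ∀ a : Metric.sphere (0 : Euc d) 1, ∫⁻ z, bandFun d t (a, z) = 1 := fun a => by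
      simp only [bandFun]
      rw [lintegral_indicator_one (measurableSet_abs_sub_le _ _), volume_abs_sub_le]
      norm_num
    simp [this]
  · intro m t u x _
    have hm : ∀ t : Fin m → Euc d,
        Measurable fun s => ⨆ k, bandFun d (t k) s / ENNReal.ofReal (x k) := fun t =>
      Measurable.iSup fun k => (measurable_bandFun d _).div_const _
    rw [lintegral_prod _ (hm _).aemeasurable, lintegral_prod _ (hm _).aemeasurable]
    refine lintegral_congr fun a => ?_
    -- For a fixed direction `a`, translating by `u` shifts the band offsets by `⟨a, u⟩`, which
    -- Lebesgue measure absorbs.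
    rw [← lintegral_add_right_eq_self _ (inner ℝ (a : Euc d) u)]
    refine lintegral_congr fun z => iSup_congr fun k => ?_
    congr 1
    simp only [bandFun, indicator_apply, mem_ofPred_eq, inner_add_right, add_sub_add_right_eq_sub,
      Pi.one_apply]

theorem tentTB_mem_radialConvexTCF : tentTB d ∈ radialConvexTCF d :=
  ⟨turningBandsOne_tent_eq_radialFun d ▸ turningBandsOne_tent_mem_tcfSet d,
    (continuous_tentTB d).continuousOn, convexOn_tentTB d, tendsto_tentTB_atTop d⟩

end TurningBands

/-! ### The M3r process on the line with random interval shapes -/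

section Interval

theorem measurePreserving_euc_one_coord :
    MeasurePreserving (fun x : Euc 1 => x 0) volume volume :=
  (volume_preserving_funUnique (Fin 1) ℝ).comp
    (PiLp.volume_preserving_ofLp (Fin 1))

theorem norm_euc_one (x : Euc 1) : ‖x‖ = |x 0| := by
  rw [EuclideanSpace.norm_eq]; simp [Real.sqrt_sq_eq_abs]

variable (d : ℕ) [NeZero d]

/-- The centred interval of length `1 / |a 0|`, as a shape of height `|a 0|`. -/
noncomputable def intervalShape (a : Metric.sphere (0 : Euc d) 1) (t : Euc 1) : ℝ≥0∞ :=
  if 2 * ‖t‖ * |(a : Euc d) 0| ≤ 1 then ENNReal.ofReal |(a : Euc d) 0| else 0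

theorem measurable_intervalShape : Measurable (Function.uncurry (intervalShape d)) := by
  refine Measurable.ite (isClosed_le ?_ continuous_const).measurableSet ?_ measurable_const
  · fun_prop
  · exact ENNReal.measurable_ofReal.comp (Continuous.measurable (by fun_prop))

theorem intervalShape_sub {a : Metric.sphere (0 : Euc d) 1} (ha : (a : Euc d) 0 ≠ 0)
    (t z : Euc 1) : intervalShape d a (t - z) =
      {y : ℝ | |t 0 - y| ≤ 1 / (2 * |(a : Euc d) 0|)}.indicator
      (fun _ => ENNReal.ofReal |(a : Euc d) 0|) (z 0) := by
  have h0 : 0 < |(a : Euc d) 0| := abs_pos.2 ha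
  have : 2 * |t 0 - z 0| * |(a : Euc d) 0| ≤ 1 ↔ |t 0 - z 0| ≤ 1 / (2 * |(a : Euc d) 0|) := by
    rw [le_div_iff₀ (by positivity)]
    constructor <;> intro h <;> linarith
  simp only [intervalShape, indicator_apply, mem_ofPred_eq, norm_euc_one, PiLp.sub_apply, this]

/-- The two intervals overlap in length `(1 / |a 0| - |s 0 - t 0|)₊`; multiplying by the height `|a
0|` gives the tent. -/
theorem lintegral_min_intervalShape {a : Metric.sphere (0 : Euc d) 1} (ha : (a : Euc d) 0 ≠ 0)
    (s t : Euc 1) : ∫⁻ z, min (intervalShape d a (s - z)) (intervalShape d a (t - z)) =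
      ENNReal.ofReal (tent ((a : Euc d) 0 * (s 0 - t 0))) := by
  have h0 : 0 < |(a : Euc d) 0| := abs_pos.2 ha
  set h := 1 / (2 * |(a : Euc d) 0|) with hh
  have hm : MeasurableSet {y : ℝ | |s 0 - y| ≤ h ∧ |t 0 - y| ≤ h} :=
    (measurableSet_abs_sub_le _ _).inter (measurableSet_abs_sub_le _ _)
  have hmin : ∀ z : Euc 1, min (intervalShape d a (s - z)) (intervalShape d a (t - z)) =
      {y : ℝ | |s 0 - y| ≤ h ∧ |t 0 - y| ≤ h}.indicator
        (fun _ => ENNReal.ofReal |(a : Euc d) 0|) (z 0) := fun z => by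
    rw [intervalShape_sub d ha, intervalShape_sub d ha, ← hh]
    simp only [indicator_apply, mem_ofPred_eq]
    exact min_ite_zero _
  simp_rw [hmin]
  rw [measurePreserving_euc_one_coord.lintegral_comp (measurable_const.indicator hm),
    lintegral_indicator_const hm, volume_abs_sub_le_inter, ← ENNReal.ofReal_mul h0.le, ofReal_tent,
    mul_sub, abs_mul, hh]
  congr 2
  field_simp

theorem lintegral_intervalShape_sub {a : Metric.sphere (0 : Euc d) 1} (ha : (a : Euc d) 0 ≠ 0)
    (t : Euc 1) : ∫⁻ z, intervalShape d a (t - z) = 1 := by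
  have := lintegral_min_intervalShape d ha t t
  simpa [tent] using this

theorem isRadialShape_intervalShape :
    IsRadialShape (uniformSphere d) (intervalShape d) where
  isProbabilityMeasure := inferInstance
  measurable := measurable_intervalShape d
  lintegral_eq_one := by
    rw [lintegral_congr_ae (g := fun _ => 1)]
    · simp
    · filter_upwards [ae_uniformSphere_coord_ne_zero d] with a ha
      rw [← lintegral_intervalShape_sub d ha 0, lintegral_sub_left_eq_self]
  radial_antitone a s t hst := by
    unfold intervalShape
    split_ifs with h1 h2
    · exact le_rfl
    · refine absurd (le_trans ?_ h1) h2
      gcongr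
    · exact zero_le
    · exact le_rfl

theorem radialFun_one_tentTB_mem_tcfM3r : radialFun 1 (tentTB d) ∈ tcfM3r 1 := by
  have hV : ∀ t : Euc 1, Measurable fun s : Euc 1 × Metric.sphere (0 : Euc d) 1 =>
      intervalShape d s.2 (t - s.1) := fun t =>
    (measurable_intervalShape d).comp
      (f := fun s : Euc 1 × Metric.sphere (0 : Euc d) 1 => (s.2, t - s.1)) (by fun_prop)
  obtain ⟨Ω, mΩ, P, X, hP, hX, h⟩ := exists_hasSpectralRepresentation
    ((volume : Measure (Euc 1)).prod (uniformSphere d)) hV fun t => by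
      rw [lintegral_prod_symm' _ (hV t), lintegral_congr_ae (g := fun _ => 1)]
      · simp
      · filter_upwards [ae_uniformSphere_coord_ne_zero d] with a ha
        exact lintegral_intervalShape_sub d ha t
  refine ⟨Ω, mΩ, P, X, hP, hX, ⟨_, _, _, _, isRadialShape_intervalShape d, h⟩, ?_⟩
  refine (?_ : radialFun 1 (tentTB d) = _) ▸ h.hasTCF hX
  ext t
  rw [lintegral_prod_symm' _ ((hV 0).min (hV t)), radialFun, tentTB_eq_integral,
    ← toReal_lintegral_ofReal_tent (by fun_prop)]
  congr 1
  refine lintegral_congr_ae ?_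
  filter_upwards [ae_uniformSphere_coord_ne_zero d] with a ha
  rw [lintegral_min_intervalShape d ha, ofReal_tent, ofReal_tent, abs_mul, abs_mul, norm_euc_one]
  simp

end Interval

theorem proposition4p8 (d : ℕ) [NeZero d] :
    -- the function `TB^d_1(tent)` is radial, with profile `φ_d = tentTB d`
    turningBandsOne d tent = radialFun d (tentTB d) ∧
    -- (a)
    (tentTB d ∈ radialConvexTCF d ∧
      radialFun d (tentTB d) ∈ tcfSet d ∧ radialFun 1 (tentTB d) ∈ tcfM3r 1) ∧
    -- (b)
    (∀ k : ℕ, 3 ≤ k → radialFun k (tentTB d) ∉ tcfM3r k) ∧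
    -- (c)
    (d = 1 ∨ 6 ≤ d → radialFun 2 (tentTB d) ∉ tcfM3r 2) := by
  have ha := tentTB_mem_radialConvexTCF d
  exact ⟨turningBandsOne_tent_eq_radialFun d, ⟨ha, ha.1, radialFun_one_tentTB_mem_tcfM3r d⟩,
    fun k hk => radialFun_notMem_tcfM3r (by omega) (tentTB_second_difference d),
    fun _ => radialFun_notMem_tcfM3r le_rfl (tentTB_second_difference d)⟩
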